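/- Let $n\ge 1$, let $A=[a_{ij}]\in\mathbb{R}^{n\times n}$ have zero diagonal, and let $\kappa>0$. Let $\mathcal G(A)$ be the signed digraph on $\{1,\dots,n\}$ with an edge from $j$ to $i$ if and only if $a_{ij}\neq 0$, and let $L=D-A$ be its Laplacian, where $D=\mathrm{diag}(d_1,\dots,d_n)$ and $d_i=\sum_{j}|a_{ij}|$. For a vector $\zeta$ write $D_\zeta=\mathrm{diag}(\zeta)$. The matrix $A$ is called essentially nonnegative if there is a vector $\zeta\in\mathbb{C}^n$ with $|\zeta_i|=1$ for all $i$ such that $D_\zeta^{-1}AD_\zeta$ has nonnegative real entries. The digraph $\mathcal G(A)$ has a spanning tree if some vertex has a directed path to every other vertex. The system $$\dot x(t)=-\kappa Lx(t),\qquad t\ge 0,\quad x(t)\in\mathbb{R}^n,$$ achieves bipartite consensus if for every solution $x$ there is $a\ge 0$ such that each $x_i(t)$ converges to $a$ or to $-a$ as $t\to\infty$, and $a>0$ for at least one solution (equivalently, by linearity, for all initial states outside a proper linear subspace). Then the system achieves bipartite consensus if and only if $A$ is essentially nonnegative and $\mathcal G(A)$ has a spanning tree. In this case there is $\sigma\in\{\pm1\}^n$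 such that $D_\sigma AD_\sigma$ is a nonnegative matrix; for every such $\sigma$ there is $\eta\in\mathbb{R}^n$ with $\eta^TL=0$, $\|\eta\|_1=\sum_i|\eta_i|=1$ and $\eta=D_\sigma\nu$ for some entrywise nonnegative $\nu\in\mathbb{R}^n$; and for all such $\sigma,\eta$ and every initial state $x(0)\in\mathbb{R}^n$ the solution satisfies $$\lim_{t\to\infty}x(t)=(\eta^Tx(0))\,\sigma .$$ -/

import Mathlib

namespace SignedConsensus

/-- The digraph `G(A)` of a square matrix: there is an edge from `j` to `i` iff `A i j ≠ 0`. -/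
def graphOf {n : ℕ} (A : Matrix (Fin n) (Fin n) ℝ) : Digraph (Fin n) where
  Adj j i := A i j ≠ 0

/-- A digraph has a (directed) spanning tree if some vertex, a root, has a directed path to every
other vertex. -/
def HasSpanningTree {V : Type*} (G : Digraph V) : Prop :=
  ∃ r : V, ∀ v : V, v ≠ r → Relation.ReflTransGen G.Adj r v

/-- The Laplacian `L = D - A`, where `D` is diagonal with entries `d i = ∑ j, |A i j|`
(the non-neighbours of `i` contribute zero to this sum). -/
def laplacian {n : ℕ} (A : Matrix (Fin n) (Fin n) ℝ) : Matrix (Fin n) (Fin n) ℝ :=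
  Matrix.diagonal (fun i => ∑ j, |A i j|) - A

/-- The diagonal matrix `D_ζ` of a vector `ζ` of unit complex numbers. -/
noncomputable def diagCircle {n : ℕ} (ζ : Fin n → Circle) : Matrix (Fin n) (Fin n) ℂ :=
  Matrix.diagonal (fun i => (ζ i : ℂ))

/-- Switching equivalence: `A₂ = D_ζ⁻¹ A₁ D_ζ` for some vector `ζ` of unit complex numbers. -/
def SwitchingEquivalent {n : ℕ} (A₁ A₂ : Matrix (Fin n) (Fin n) ℂ) : Prop :=
  ∃ ζ : Fin n → Circle, A₂ = (diagCircle ζ)⁻¹ * A₁ * diagCircle ζ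

/-- A complex matrix is essentially nonnegative if it is switching equivalent to a matrix with
nonnegative real entries. -/
def EssentiallyNonnegative {n : ℕ} (A : Matrix (Fin n) (Fin n) ℂ) : Prop :=
  ∃ B : Matrix (Fin n) (Fin n) ℝ, (∀ i j, 0 ≤ B i j) ∧
    SwitchingEquivalent A (B.map Complex.ofReal)

/-- `x` solves `ẋ(t) = -κ L x(t)` for `t ≥ 0` (with the one-sided derivative at `t = 0`). -/
def IsSolution {n : ℕ} (κ : ℝ) (A : Matrix (Fin n) (Fin n) ℝ) (x : ℝ → Fin n → ℝ) : Prop :=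
  ∀ t : ℝ, 0 ≤ t →
    HasDerivWithinAt x (-(κ • (laplacian A).mulVec (x t))) (Set.Ici 0) t

/-- Along the trajectory `x`, every agent converges to `a` or to `-a`. -/
def ConvergesUpToSign {n : ℕ} (x : ℝ → Fin n → ℝ) (a : ℝ) : Prop :=
  ∀ i, Filter.Tendsto (fun t => x t i) Filter.atTop (nhds a) ∨
    Filter.Tendsto (fun t => x t i) Filter.atTop (nhds (-a))

/-- The system `ẋ = -κ L x` achieves bipartite consensus: along every solution all agents converge
to a common value up to sign, and this common modulus is not always zero. (It cannot be positive
for every initial state, as `x(0) = 0` shows; by linearity, once it is positive for one initial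
state it is positive for all initial states outside a proper linear subspace.) -/
def AchievesBipartiteConsensus {n : ℕ} (κ : ℝ) (A : Matrix (Fin n) (Fin n) ℝ) : Prop :=
  (∀ x, IsSolution κ A x → ∃ a : ℝ, 0 ≤ a ∧ ConvergesUpToSign x a) ∧
    ∃ x, IsSolution κ A x ∧ ∃ a : ℝ, 0 < a ∧ ConvergesUpToSign x a

/-- `σ ∈ {±1}ⁿ` and `D_σ A D_σ` is a nonnegative matrix. -/
def IsSignSwitching {n : ℕ} (A : Matrix (Fin n) (Fin n) ℝ) (σ : Fin n → ℝ) : Prop :=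
  (∀ i, σ i = 1 ∨ σ i = -1) ∧
    ∀ i j, 0 ≤ (Matrix.diagonal σ * A * Matrix.diagonal σ) i j

/-- `ηᵀ L = 0`, `‖η‖₁ = 1`, and `η = D_σ ν` with `ν` entrywise nonnegative. The last condition
selects, among the two vectors `η` and `-η`, the one that goes with `σ`. -/
def IsNormalizedLeftNull {n : ℕ} (A : Matrix (Fin n) (Fin n) ℝ) (σ η : Fin n → ℝ) : Prop :=
  Matrix.vecMul η (laplacian A) = 0 ∧ ∑ i, |η i| = 1 ∧
    ∃ ν : Fin n → ℝ, (∀ i, 0 ≤ ν i) ∧ η = (Matrix.diagonal σ).mulVec ν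

end SignedConsensus

namespace SignedConsensus

open Filter Topology Matrix

/-! Up to the change of signs `D_σ`, sufficiency is consensus for a nonnegative matrix. In that case
`-κL + cI` is entrywise nonnegative for large `c`, so the flow `exp(-κtL)` is order preserving, and
it fixes constants. For a root `r`, the `r`-th column of the time-one flow is strictly positive, so
that map shrinks the oscillation of every state by a fixed factor (Doeblin's argument) and every
trajectory tends to a constant. A left null vector of `L` gives a conserved quantity, which
identifies the constant (`tendsto_flow_const`).

Conversely, a limit `w` with entries `±a`, `a > 0`, is an equilibrium. Each row of `Lw = 0` is then
an equality case of the triangle inequality, which forces `w i * A i j * w j ≥ 0`, so `w / a` is a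
sign switching. Two vertices without a common ancestor would have ancestor sets that evolve
independently, and their limits could be given different moduli. So any two vertices have a common
ancestor, and finiteness yields a root. -/

/-- The generator `x ↦ -κ L x` of the system, as a continuous linear map. -/
noncomputable def generator {n : ℕ} (κ : ℝ) (A : Matrix (Fin n) (Fin n) ℝ) :
    (Fin n → ℝ) →L[ℝ] (Fin n → ℝ) :=
  -(κ • LinearMap.toContinuousLinearMap (Matrix.mulVecLin (laplacian A)))

/-- The flow `exp (-κ t L)` of the system. -/
noncomputable def flow {n : ℕ} (κ : ℝ) (A : Matrix (Fin n) (Fin n) ℝ) (t : ℝ) :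
    (Fin n → ℝ) →L[ℝ] (Fin n → ℝ) :=
  NormedSpace.exp (t • generator κ A)

/-! ### The linear flow and its equilibria -/

section Flow

variable {n : ℕ} {κ : ℝ} {A : Matrix (Fin n) (Fin n) ℝ}

theorem generator_apply (v : Fin n → ℝ) : generator κ A v = -(κ • laplacian A *ᵥ v) := rfl

theorem laplacian_mulVec_apply (v : Fin n → ℝ) (i : Fin n) :
    (laplacian A *ᵥ v) i = (∑ j, |A i j|) * v i - ∑ j, A i j * v j := by
  rw [laplacian, Matrix.sub_mulVec, Pi.sub_apply, Matrix.mulVec_diagonal]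
  rfl

theorem flow_zero : flow κ A 0 = 1 := by
  simp [flow, NormedSpace.exp_zero]

theorem flow_add (s t : ℝ) : flow κ A (s + t) = flow κ A s * flow κ A t := by
  rw [flow, add_smul]
  let := NormedAlgebra.restrictScalars ℚ ℝ ((Fin n → ℝ) →L[ℝ] (Fin n → ℝ))
  exact NormedSpace.exp_add_of_commute
    (((Commute.refl (generator κ A)).smul_left s).smul_right t)

theorem hasDerivAt_flow_apply (v : Fin n → ℝ) (t : ℝ) :
    HasDerivAt (fun s => flow κ A s v) (generator κ A (flow κ A t v)) t := by
  have h := (hasDerivAt_exp_smul_const' (𝕂 := ℝ) (generator κ A) t).clm_apply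
    (hasDerivAt_const t v)
  rwa [map_zero, add_zero] at h

theorem isSolution_flow (v : Fin n → ℝ) : IsSolution κ A (fun t => flow κ A t v) :=
  fun t _ => (hasDerivAt_flow_apply v t).hasDerivWithinAt

theorem IsSolution.eq_flow {x : ℝ → Fin n → ℝ} (hx : IsSolution κ A x) {t : ℝ} (ht : 0 ≤ t) :
    x t = flow κ A t (x 0) := by
  have cont : ∀ y, IsSolution κ A y → ContinuousOn y (Set.Icc 0 t) := fun y hy s hs =>
    ((hy s hs.1).continuousWithinAt).mono Set.Icc_subset_Ici_self
  have der : ∀ y, IsSolution κ A y → ∀ s ∈ Set.Ico 0 t,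
      HasDerivWithinAt y (generator κ A (y s)) (Set.Ici s) s := fun y hy s hs =>
    (hy s hs.1).mono (Set.Ici_subset_Ici.2 hs.1)
  refine ODE_solution_unique (v := fun _ => generator κ A)
    (fun _ => (generator κ A).lipschitz) (cont x hx) (der x hx)
    (cont _ (isSolution_flow (x 0))) (der _ (isSolution_flow (x 0))) ?_ ⟨ht, le_rfl⟩
  simp [flow_zero]

theorem IsSolution.eventuallyEq_flow {x : ℝ → Fin n → ℝ} (hx : IsSolution κ A x) :
    x =ᶠ[atTop] fun t => flow κ A t (x 0) :=
  (eventually_ge_atTop 0).mono fun _ ht => hx.eq_flow ht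

theorem isSolution_const {w : Fin n → ℝ} (hw : laplacian A *ᵥ w = 0) :
    IsSolution κ A (fun _ => w) := by
  intro t _
  simpa [hw] using hasDerivWithinAt_const t (Set.Ici 0) w

theorem flow_apply_of_laplacian_eq_zero {w : Fin n → ℝ} (hw : laplacian A *ᵥ w = 0)
    {t : ℝ} (ht : 0 ≤ t) : flow κ A t w = w :=
  ((isSolution_const hw).eq_flow ht).symm

theorem commute_generator_flow (t : ℝ) : Commute (generator κ A) (flow κ A t) :=
  ((Commute.refl (generator κ A)).smul_right t).exp_right

/-- The limit of a trajectory is an equilibrium. -/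
theorem laplacian_eq_zero_of_tendsto_flow (hκ : κ ≠ 0) {v w : Fin n → ℝ}
    (h : Tendsto (fun t => flow κ A t v) atTop (𝓝 w)) : laplacian A *ᵥ w = 0 := by
  -- Applying the flow for time `s` only shifts the trajectory in time, so it fixes the limit.
  have fixed : ∀ s, flow κ A s w = w := fun s => by
    refine tendsto_nhds_unique (((flow κ A s).continuous.tendsto w).comp h) ?_
    refine (h.comp (tendsto_atTop_add_const_left atTop s tendsto_id)).congr fun t => ?_
    simp [flow_add]
  have hd := hasDerivAt_flow_apply (κ := κ) (A := A) w 0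
  simp only [fixed] at hd
  have := hd.unique (hasDerivAt_const 0 w)
  simpa [generator_apply, hκ] using this

/-- A subspace invariant under the generator is invariant under the flow. -/
theorem flow_apply_mem {W : Submodule ℝ (Fin n → ℝ)} (hW : ∀ w ∈ W, generator κ A w ∈ W)
    {w : Fin n → ℝ} (hw : w ∈ W) (t : ℝ) : flow κ A t w ∈ W := by
  have hs := (NormedSpace.exp_series_hasSum_exp' (𝕂 := ℝ) (t • generator κ A)).mapL
    (ContinuousLinearMap.apply ℝ (Fin n → ℝ) w)
  refine W.closed_of_finiteDimensional.mem_of_tendsto hs (Eventually.of_forall fun s => ?_)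
  refine W.sum_mem fun k _ => ?_
  have hk (k : ℕ) : ((t • generator κ A) ^ k) w ∈ W := by
    induction k with
    | zero => simpa using hw
    | succ k ih =>
      rw [pow_succ']
      exact W.smul_mem _ (hW _ ih)
  simpa using W.smul_mem _ (hk k)

end Flow

/-! ### Positivity of the flow of a nonnegative matrix -/

section Positivity

variable {n : ℕ}

theorem pow_apply_nonneg {N : (Fin n → ℝ) →L[ℝ] (Fin n → ℝ)} (hN : ∀ x, 0 ≤ x → 0 ≤ N x)
    {x : Fin n → ℝ} (hx : 0 ≤ x) (k : ℕ) : 0 ≤ (N ^ k) x := by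
  induction k with
  | zero => simpa using hx
  | succ k ih => rw [pow_succ']; exact hN _ ih

/-- All the other terms of the exponential series are nonnegative. -/
theorem le_exp_apply {N : (Fin n → ℝ) →L[ℝ] (Fin n → ℝ)} (hN : ∀ x, 0 ≤ x → 0 ≤ N x)
    {x : Fin n → ℝ} (hx : 0 ≤ x) (k : ℕ) :
    ((k.factorial : ℝ)⁻¹) • (N ^ k) x ≤ NormedSpace.exp N x := by
  have hs := (NormedSpace.exp_series_hasSum_exp' (𝕂 := ℝ) N).mapL
    (ContinuousLinearMap.apply ℝ (Fin n → ℝ) x)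
  refine le_hasSum hs k fun j (_ : j ≠ k) => ?_
  exact smul_nonneg (α := ℝ) (inv_nonneg.2 (Nat.cast_nonneg _)) (pow_apply_nonneg hN hx j)

theorem exp_apply_nonneg {N : (Fin n → ℝ) →L[ℝ] (Fin n → ℝ)} (hN : ∀ x, 0 ≤ x → 0 ≤ N x)
    {x : Fin n → ℝ} (hx : 0 ≤ x) : 0 ≤ NormedSpace.exp N x :=
  (smul_nonneg (inv_nonneg.2 (Nat.cast_nonneg _)) (pow_apply_nonneg hN hx 0)).trans (le_exp_apply hN hx 0)

/-- The generator, shifted by a multiple of the identity large enough to make it positive when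
the matrix is. -/
noncomputable def shiftedGenerator (κ : ℝ) (A : Matrix (Fin n) (Fin n) ℝ) :
    (Fin n → ℝ) →L[ℝ] (Fin n → ℝ) :=
  generator κ A + (κ * ∑ i, ∑ j, |A i j|) • 1

variable {κ : ℝ} {A : Matrix (Fin n) (Fin n) ℝ}

/-- The shift dominates every diagonal entry `κ d i` of `κL`, so only nonnegative terms are
discarded. -/
theorem mul_le_shiftedGenerator_apply (hκ : 0 < κ) (hA : ∀ i j, 0 ≤ A i j) {x : Fin n → ℝ}
    (hx : 0 ≤ x) (i j : Fin n) : κ * (A i j * x j) ≤ shiftedGenerator κ A x i := by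
  have hrow : ∑ j, |A i j| ≤ ∑ i, ∑ j, |A i j| :=
    Finset.single_le_sum (f := fun i => ∑ j, |A i j|)
      (fun i _ => Finset.sum_nonneg fun j _ => abs_nonneg _) (Finset.mem_univ i)
  have hterm : A i j * x j ≤ ∑ j, A i j * x j :=
    Finset.single_le_sum (f := fun j => A i j * x j)
      (fun j _ => mul_nonneg (hA i j) (hx j)) (Finset.mem_univ j)
  have heq : shiftedGenerator κ A x i = κ * ∑ j, A i j * x j +
      κ * ((∑ i, ∑ j, |A i j|) - ∑ j, |A i j|) * x i := by
    simp only [shiftedGenerator, _root_.add_apply, Pi.add_apply, generator_apply, Pi.neg_apply,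
      Pi.smul_apply, laplacian_mulVec_apply, _root_.smul_apply, one_apply_eq_self, smul_eq_mul]
    ring
  rw [heq]
  have h1 := mul_le_mul_of_nonneg_left hterm hκ.le
  have h2 := mul_nonneg (mul_nonneg hκ.le (sub_nonneg.2 hrow)) (hx i)
  linarith

theorem shiftedGenerator_apply_nonneg (hκ : 0 < κ) (hA : ∀ i j, 0 ≤ A i j) (x : Fin n → ℝ)
    (hx : 0 ≤ x) : 0 ≤ shiftedGenerator κ A x := fun i =>
  (mul_nonneg hκ.le (mul_nonneg (hA i i) (hx i))).trans
    (mul_le_shiftedGenerator_apply hκ hA hx i i)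

/-- Each edge of the path costs one more power. -/
theorem exists_pow_shiftedGenerator_pos (hκ : 0 < κ) (hA : ∀ i j, 0 ≤ A i j) {r v : Fin n}
    (h : Relation.ReflTransGen (graphOf A).Adj r v) :
    ∃ k : ℕ, 0 < (shiftedGenerator κ A ^ k) (Pi.single r 1) v := by
  induction h with
  | refl => exact ⟨0, by simp⟩
  | @tail v w _ hvw ih =>
    obtain ⟨k, hk⟩ := ih
    refine ⟨k + 1, ?_⟩
    have hpos : 0 < A w v := lt_of_le_of_ne (hA w v) (Ne.symm hvw)
    have hsingle : (0 : Fin n → ℝ) ≤ Pi.single r 1 := Pi.single_nonneg.2 zero_le_one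
    rw [pow_succ']
    exact (mul_pos hκ (mul_pos hpos hk)).trans_le (mul_le_shiftedGenerator_apply hκ hA
      (pow_apply_nonneg (shiftedGenerator_apply_nonneg hκ hA) hsingle k) w v)

theorem flow_eq_smul_exp (t : ℝ) :
    flow κ A t = Real.exp (-(t * (κ * ∑ i, ∑ j, |A i j|))) •
      NormedSpace.exp (t • shiftedGenerator κ A) := by
  set c := κ * ∑ i, ∑ j, |A i j| with hc
  let := NormedAlgebra.restrictScalars ℚ ℝ ((Fin n → ℝ) →L[ℝ] (Fin n → ℝ))
  have hsplit : t • generator κ A =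
      algebraMap ℝ ((Fin n → ℝ) →L[ℝ] (Fin n → ℝ)) (-(t * c)) + t • shiftedGenerator κ A := by
    rw [shiftedGenerator, ← hc, Algebra.algebraMap_eq_smul_one]
    module
  rw [flow, hsplit, NormedSpace.exp_add_of_commute (Algebra.commutes _ _),
    ← NormedSpace.algebraMap_exp_comm, ← Real.exp_eq_exp_ℝ, Algebra.algebraMap_eq_smul_one,
    smul_mul_assoc, one_mul]

theorem flow_apply_nonneg (hκ : 0 < κ) (hA : ∀ i j, 0 ≤ A i j) {t : ℝ} (ht : 0 ≤ t)
    {x : Fin n → ℝ} (hx : 0 ≤ x) : 0 ≤ flow κ A t x := by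
  rw [flow_eq_smul_exp]
  exact smul_nonneg (Real.exp_nonneg _) (exp_apply_nonneg
    (fun y hy => smul_nonneg ht (shiftedGenerator_apply_nonneg hκ hA y hy)) hx)

theorem flow_apply_mono (hκ : 0 < κ) (hA : ∀ i j, 0 ≤ A i j) {t : ℝ} (ht : 0 ≤ t)
    {x y : Fin n → ℝ} (hxy : x ≤ y) : flow κ A t x ≤ flow κ A t y := by
  have := flow_apply_nonneg hκ hA ht (sub_nonneg.2 hxy)
  rwa [map_sub, sub_nonneg] at this

theorem flow_one_single_pos (hκ : 0 < κ) (hA : ∀ i j, 0 ≤ A i j) {r v : Fin n}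
    (h : Relation.ReflTransGen (graphOf A).Adj r v) :
    0 < flow κ A 1 (Pi.single r 1) v := by
  obtain ⟨k, hk⟩ := exists_pow_shiftedGenerator_pos hκ hA h
  have hle := le_exp_apply (shiftedGenerator_apply_nonneg hκ hA)
    (Pi.single_nonneg.2 zero_le_one : (0 : Fin n → ℝ) ≤ Pi.single r 1) k v
  rw [flow_eq_smul_exp, one_smul]
  refine mul_pos (Real.exp_pos _) (lt_of_lt_of_le ?_ hle)
  exact mul_pos (by positivity) hk

end Positivity

/-! ### Consensus for nonnegative matrices -/

section Nonnegative

variable {n : ℕ} {κ : ℝ} {A : Matrix (Fin n) (Fin n) ℝ}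

theorem laplacian_mulVec_const (hA : ∀ i j, 0 ≤ A i j) (c : ℝ) :
    laplacian A *ᵥ (fun _ => c) = 0 := by
  funext i
  simp [laplacian_mulVec_apply, abs_of_nonneg (hA i _), Finset.sum_mul]

theorem flow_apply_const (hA : ∀ i j, 0 ≤ A i j) {t : ℝ} (ht : 0 ≤ t) (c : ℝ) :
    flow κ A t (fun _ => c) = fun _ => c :=
  flow_apply_of_laplacian_eq_zero (laplacian_mulVec_const hA c) ht

theorem HasSpanningTree.exists_root {V : Type*} {G : Digraph V} (h : HasSpanningTree G) :
    ∃ r, ∀ v, Relation.ReflTransGen G.Adj r v := by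
  obtain ⟨r, hr⟩ := h
  refine ⟨r, fun v => ?_⟩
  by_cases hv : v = r
  · subst hv; exact .refl
  · exact hr v hv

/-- The time-one flow contracts the oscillation of every state by a fixed factor. -/
theorem exists_contraction_flow_one (hκ : 0 < κ) (hA : ∀ i j, 0 ≤ A i j)
    (htree : HasSpanningTree (graphOf A)) :
    ∃ ρ : ℝ, 0 ≤ ρ ∧ ρ < 1 ∧ ∀ (x : Fin n → ℝ) (m M : ℝ), (∀ i, x i ∈ Set.Icc m M) →
      ∃ m' M' : ℝ, M' - m' = ρ * (M - m) ∧ ∀ i, flow κ A 1 x i ∈ Set.Icc m' M' := by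
  obtain ⟨r, hr⟩ := htree.exists_root
  have : Nonempty (Fin n) := ⟨r⟩
  obtain ⟨i₀, hi₀⟩ := Finite.exists_min (flow κ A 1 (Pi.single r 1))
  -- The smallest entry of the root's column in the time-one flow.
  set δ := flow κ A 1 (Pi.single r 1) i₀ with hδ
  have hδ0 : 0 < δ := flow_one_single_pos hκ hA (hr i₀)
  have hδ1 : δ ≤ 1 := by
    have h := flow_apply_mono hκ hA zero_le_one
      (x := Pi.single r 1) (y := fun _ => 1) (fun i => by
        by_cases h : i = r
        · subst h; simp
        · simp [h]) i₀
    rwa [flow_apply_const hA zero_le_one] at h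
  refine ⟨1 - δ, by linarith, by linarith, fun x m M hx => ?_⟩
  -- From `m + (x r - m) e_r ≤ x ≤ M - (M - x r) e_r`, monotonicity and the bound `δ` on the column;
  -- the two gains add up to `δ (M - m)`.
  refine ⟨m + δ * (x r - m), M - δ * (M - x r), by ring, fun i => ⟨?_, ?_⟩⟩
  · have h := flow_apply_mono hκ hA zero_le_one
      (x := (fun _ => m) + (x r - m) • Pi.single r 1) (y := x) (fun i => by
        by_cases h : i = r
        · subst h; simp
        · simpa [h] using (hx i).1) i
    rw [map_add, map_smul, flow_apply_const hA zero_le_one] at h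
    simp only [Pi.add_apply, Pi.smul_apply, smul_eq_mul] at h
    have := mul_le_mul_of_nonneg_left (hi₀ i) (sub_nonneg.2 (hx r).1)
    linarith
  · have h := flow_apply_mono hκ hA zero_le_one
      (x := x) (y := (fun _ => M) - (M - x r) • Pi.single r 1) (fun i => by
        by_cases h : i = r
        · subst h; simp
        · simpa [h] using (hx i).2) i
    rw [map_sub, map_smul, flow_apply_const hA zero_le_one] at h
    simp only [Pi.sub_apply, Pi.smul_apply, smul_eq_mul] at h
    have := mul_le_mul_of_nonneg_left (hi₀ i) (sub_nonneg.2 (hx r).2)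
    linarith

theorem flow_apply_mem_Icc (hκ : 0 < κ) (hA : ∀ i j, 0 ≤ A i j) {t : ℝ} (ht : 0 ≤ t)
    {x : Fin n → ℝ} {m M : ℝ} (hx : ∀ i, x i ∈ Set.Icc m M) (i : Fin n) :
    flow κ A t x i ∈ Set.Icc m M := by
  have h1 := flow_apply_mono hκ hA ht (x := fun _ => m) (y := x) (fun i => (hx i).1) i
  have h2 := flow_apply_mono hκ hA ht (x := x) (y := fun _ => M) (fun i => (hx i).2) i
  rw [flow_apply_const hA ht] at h1 h2
  exact ⟨h1, h2⟩

theorem exists_geometric_oscillation_bound (hκ : 0 < κ) (hA : ∀ i j, 0 ≤ A i j)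
    (htree : HasSpanningTree (graphOf A)) (x : Fin n → ℝ) :
    ∃ ρ C : ℝ, 0 ≤ ρ ∧ ρ < 1 ∧ ∀ k : ℕ, ∃ m M : ℝ, M - m = ρ ^ k * C ∧
      ∀ t : ℝ, k ≤ t → ∀ i, flow κ A t x i ∈ Set.Icc m M := by
  obtain ⟨ρ, hρ0, hρ1, hρ⟩ := exists_contraction_flow_one hκ hA htree
  refine ⟨ρ, ‖x‖ - -‖x‖, hρ0, hρ1, fun k => ?_⟩
  suffices h : ∃ m M : ℝ, M - m = ρ ^ k * (‖x‖ - -‖x‖) ∧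
      ∀ i, flow κ A k x i ∈ Set.Icc m M by
    obtain ⟨m, M, hmM, h⟩ := h
    refine ⟨m, M, hmM, fun t ht i => ?_⟩
    have := flow_apply_mem_Icc hκ hA (sub_nonneg.2 ht) h i
    rwa [← mul_apply_eq_comp, ← flow_add, sub_add_cancel] at this
  induction k with
  | zero =>
    refine ⟨-‖x‖, ‖x‖, by simp, fun i => ?_⟩
    simpa [flow_zero] using abs_le.1 (norm_le_pi_norm x i)
  | succ k ih =>
    obtain ⟨m, M, hmM, h⟩ := ih
    obtain ⟨m', M', hmM', h'⟩ := hρ _ m M h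
    refine ⟨m', M', by rw [hmM', hmM]; ring, fun i => ?_⟩
    have := h' i
    rwa [← mul_apply_eq_comp, ← flow_add, add_comm, ← Nat.cast_succ] at this

/-- Consensus for nonnegative matrices. -/
theorem exists_tendsto_flow_const (hκ : 0 < κ) (hA : ∀ i j, 0 ≤ A i j)
    (htree : HasSpanningTree (graphOf A)) (x : Fin n → ℝ) :
    ∃ c : ℝ, Tendsto (fun t => flow κ A t x) atTop (𝓝 fun _ => c) := by
  obtain ⟨ρ, C, hρ0, hρ1, h⟩ := exists_geometric_oscillation_bound hκ hA htree x
  have hlim : Tendsto (fun k : ℕ => ρ ^ k * C) atTop (𝓝 0) := by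
    simpa using (tendsto_pow_atTop_nhds_zero_of_lt_one hρ0 hρ1).mul_const C
  have hcauchy : CauchySeq (fun t => flow κ A t x) := by
    refine Metric.cauchySeq_iff'.2 fun ε hε => ?_
    obtain ⟨k, hk⟩ := (hlim.eventually_lt_const hε).exists
    obtain ⟨m, M, hmM, hb⟩ := h k
    refine ⟨k, fun t ht => (dist_pi_lt_iff hε).2 fun i => ?_⟩
    exact (Real.dist_le_of_mem_Icc (hb t ht i) (hb k le_rfl i)).trans_lt (hmM ▸ hk)
  obtain ⟨w, hw⟩ := cauchySeq_tendsto_of_complete hcauchy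
  obtain ⟨r, -⟩ := htree
  refine ⟨w r, ?_⟩
  suffices hwr : w = fun _ => w r by rwa [hwr] at hw
  funext i
  refine dist_le_zero.1 (ge_of_tendsto' hlim fun k => ?_)
  obtain ⟨m, M, hmM, hb⟩ := h k
  refine hmM ▸ le_of_tendsto ((tendsto_pi_nhds.1 hw i).dist (tendsto_pi_nhds.1 hw r)) ?_
  filter_upwards [eventually_ge_atTop (k : ℝ)] with t ht
  exact Real.dist_le_of_mem_Icc (hb t ht i) (hb t ht r)

/-- The entry `ν j` is the consensus value reached from the `j`-th basis vector, so by linearity `ν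
⬝ᵥ x` is the one reached from `x`. -/
theorem exists_nonneg_left_null (hκ : 0 < κ) (hA : ∀ i j, 0 ≤ A i j)
    (htree : HasSpanningTree (graphOf A)) :
    ∃ ν : Fin n → ℝ, (∀ i, 0 ≤ ν i) ∧ ∑ i, ν i = 1 ∧ ν ᵥ* laplacian A = 0 := by
  choose ν hν using fun j : Fin n =>
    exists_tendsto_flow_const hκ hA htree (Pi.single j 1)
  have hlim (x : Fin n → ℝ) : Tendsto (fun t => flow κ A t x) atTop (𝓝 fun _ => ν ⬝ᵥ x) := by
    have h := tendsto_finsetSum Finset.univ fun j _ => (hν j).const_smul (x j)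
    have hx : (fun _ => ν ⬝ᵥ x) = ∑ j, x j • (fun _ : Fin n => ν j) := by
      funext i
      simp [dotProduct, mul_comm]
    rw [hx]
    refine h.congr fun t => ?_
    conv_rhs => rw [pi_eq_sum_univ' x]
    simp only [map_sum, map_smul]
  obtain ⟨r, -⟩ := id htree
  refine ⟨ν, fun j => ?_, ?_, ?_⟩
  · refine ge_of_tendsto (tendsto_pi_nhds.1 (hν j) r) ?_
    filter_upwards [eventually_ge_atTop 0] with t ht
    exact flow_apply_nonneg hκ hA ht (Pi.single_nonneg.2 zero_le_one) r
  · have h := tendsto_pi_nhds.1 (hlim fun _ => 1) r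
    have h1 : Tendsto (fun t => flow κ A t (fun _ => 1) r) atTop (𝓝 1) :=
      tendsto_const_nhds.congr' <| (eventually_ge_atTop 0).mono fun t ht => by
        simp only [flow_apply_const hA ht]
    simpa [dotProduct] using tendsto_nhds_unique h h1
  · refine dotProduct_eq_zero _ fun x => ?_
    rw [← dotProduct_mulVec]
    -- The flow commutes with the generator, which kills constants: trajectories starting in the
    -- range of `L` tend to zero, so `ν` annihilates that range.
    have h := hlim (generator κ A x)
    obtain ⟨c, hc⟩ := exists_tendsto_flow_const hκ hA htree x
    have h' : Tendsto (fun t => flow κ A t (generator κ A x)) atTop (𝓝 0) := by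
      have hgen := ((generator κ A).continuous.tendsto _).comp hc
      rw [generator_apply, laplacian_mulVec_const hA, smul_zero, neg_zero] at hgen
      exact hgen.congr fun t => congrArg (· x) (commute_generator_flow t).eq
    have := congrFun (tendsto_nhds_unique h h') r
    simpa [generator_apply, hκ.ne'] using this

theorem dotProduct_flow_apply {ν : Fin n → ℝ} (hν : ν ᵥ* laplacian A = 0) (x : Fin n → ℝ)
    (t : ℝ) : ν ⬝ᵥ flow κ A t x = ν ⬝ᵥ x := by
  have hd (s : ℝ) : HasDerivAt (fun s => ν ⬝ᵥ flow κ A s x) 0 s := by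
    have h : HasDerivAt (fun s => ν ⬝ᵥ flow κ A s x) (ν ⬝ᵥ generator κ A (flow κ A s x)) s :=
      HasDerivAt.fun_sum fun i _ =>
        (hasDerivAt_pi.1 (hasDerivAt_flow_apply x s) i).const_mul (ν i)
    simpa [generator_apply, dotProduct_mulVec, hν] using h
  have := is_const_of_deriv_eq_zero (fun s => (hd s).differentiableAt) (fun s => (hd s).deriv) t 0
  simpa [flow_zero] using this

theorem tendsto_flow_const (hκ : 0 < κ) (hA : ∀ i j, 0 ≤ A i j)
    (htree : HasSpanningTree (graphOf A)) {ν : Fin n → ℝ} (hν : ν ᵥ* laplacian A = 0)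
    (hsum : ∑ i, ν i = 1) (x : Fin n → ℝ) :
    Tendsto (fun t => flow κ A t x) atTop (𝓝 fun _ => ν ⬝ᵥ x) := by
  obtain ⟨c, hc⟩ := exists_tendsto_flow_const hκ hA htree x
  suffices h : ν ⬝ᵥ x = c by rwa [h]
  have h : Tendsto (fun t => ν ⬝ᵥ flow κ A t x) atTop (𝓝 (ν ⬝ᵥ fun _ => c)) :=
    tendsto_finsetSum _ fun i _ => (tendsto_pi_nhds.1 hc i).const_mul (ν i)
  simp only [dotProduct_flow_apply hν] at h
  rw [tendsto_nhds_unique tendsto_const_nhds h, dotProduct, ← Finset.sum_mul, hsum, one_mul]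

end Nonnegative

/-! ### Sign switchings and essential nonnegativity -/

section Switching

variable {n : ℕ} {κ : ℝ} {A : Matrix (Fin n) (Fin n) ℝ} {σ : Fin n → ℝ}

theorem diagonal_mul_mul_diagonal_apply (A : Matrix (Fin n) (Fin n) ℝ) (σ : Fin n → ℝ)
    (i j : Fin n) : (diagonal σ * A * diagonal σ) i j = σ i * A i j * σ j := by
  simp [Matrix.mul_diagonal, Matrix.diagonal_mul]

theorem IsSignSwitching.mul_self (h : IsSignSwitching A σ) (i : Fin n) : σ i * σ i = 1 := by
  rcases h.1 i with hi | hi <;> simp [hi]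

theorem IsSignSwitching.abs_eq_one (h : IsSignSwitching A σ) (i : Fin n) : |σ i| = 1 := by
  rcases h.1 i with hi | hi <;> simp [hi]

theorem IsSignSwitching.diagonal_mul_self (h : IsSignSwitching A σ) :
    diagonal σ * diagonal σ = 1 := by
  simp [Matrix.diagonal_mul_diagonal, h.mul_self]

theorem IsSignSwitching.laplacian_eq (h : IsSignSwitching A σ) :
    laplacian (diagonal σ * A * diagonal σ) = diagonal σ * laplacian A * diagonal σ := by
  have hdiag (d : Fin n → ℝ) : diagonal σ * diagonal d * diagonal σ = diagonal d := by
    simp [Matrix.diagonal_mul_diagonal, mul_right_comm _ _ (σ _), h.mul_self]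
  simp only [laplacian, diagonal_mul_mul_diagonal_apply, abs_mul, h.abs_eq_one, one_mul, mul_one,
    mul_sub, sub_mul, hdiag]

theorem IsSignSwitching.laplacian_mulVec (h : IsSignSwitching A σ) (v : Fin n → ℝ) :
    laplacian (diagonal σ * A * diagonal σ) *ᵥ (diagonal σ *ᵥ v) =
      diagonal σ *ᵥ (laplacian A *ᵥ v) := by
  rw [h.laplacian_eq, mulVec_mulVec, mulVec_mulVec, mul_assoc, h.diagonal_mul_self, mul_one]

theorem IsSignSwitching.laplacian_mulVec_self (h : IsSignSwitching A σ) :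
    laplacian A *ᵥ σ = 0 := by
  have h1 : diagonal σ *ᵥ σ = fun _ => 1 := by
    funext i; simp [mulVec_diagonal, h.mul_self]
  have h2 := h.laplacian_mulVec σ
  rw [h1, laplacian_mulVec_const h.2] at h2
  have h3 := congrArg (diagonal σ *ᵥ ·) h2
  simpa [mulVec_mulVec, ← mul_assoc, h.diagonal_mul_self] using h3.symm

theorem IsSignSwitching.vecMul_laplacian_eq_zero_iff (h : IsSignSwitching A σ)
    (ν : Fin n → ℝ) :
    (diagonal σ *ᵥ ν) ᵥ* laplacian A = 0 ↔
      ν ᵥ* laplacian (diagonal σ * A * diagonal σ) = 0 := by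
  have hν : diagonal σ *ᵥ ν = ν ᵥ* diagonal σ := by
    funext i; simp [mulVec_diagonal, vecMul_diagonal, mul_comm]
  rw [h.laplacian_eq, hν, ← vecMul_vecMul, ← vecMul_vecMul]
  refine ⟨fun h0 => by rw [h0, zero_vecMul], fun h0 => ?_⟩
  have := congrArg (· ᵥ* diagonal σ) h0
  simpa [vecMul_vecMul, mul_assoc, h.diagonal_mul_self] using this

theorem IsSignSwitching.isSolution (h : IsSignSwitching A σ) {x : ℝ → Fin n → ℝ}
    (hx : IsSolution κ A x) :
    IsSolution κ (diagonal σ * A * diagonal σ) (fun t => diagonal σ *ᵥ x t) := by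
  intro t ht
  rw [h.laplacian_mulVec, ← mulVec_smul, ← mulVec_neg]
  exact (LinearMap.toContinuousLinearMap
    (mulVecLin (diagonal σ))).hasFDerivAt.comp_hasDerivWithinAt t (hx t ht)

theorem IsSignSwitching.graphOf_eq (h : IsSignSwitching A σ) :
    graphOf (diagonal σ * A * diagonal σ) = graphOf A := by
  have hσ (i : Fin n) : σ i ≠ 0 := fun h0 => by simpa [h0] using h.mul_self i
  ext j i
  simp [graphOf, hσ]

theorem IsSignSwitching.exists_isNormalizedLeftNull (hκ : 0 < κ) (h : IsSignSwitching A σ)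
    (htree : HasSpanningTree (graphOf A)) : ∃ η, IsNormalizedLeftNull A σ η := by
  obtain ⟨ν, hν0, hν1, hν⟩ := exists_nonneg_left_null hκ h.2 (h.graphOf_eq ▸ htree)
  refine ⟨diagonal σ *ᵥ ν, (h.vecMul_laplacian_eq_zero_iff ν).2 hν, ?_, ν, hν0, rfl⟩
  simpa [mulVec_diagonal, abs_mul, h.abs_eq_one, abs_of_nonneg (hν0 _)] using hν1

theorem IsSignSwitching.tendsto (hκ : 0 < κ) (h : IsSignSwitching A σ)
    (htree : HasSpanningTree (graphOf A)) {η : Fin n → ℝ} (hη : IsNormalizedLeftNull A σ η)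
    {x : ℝ → Fin n → ℝ} (hx : IsSolution κ A x) :
    Tendsto x atTop (𝓝 ((η ⬝ᵥ x 0) • σ)) := by
  obtain ⟨hnull, hsum, ν, hν0, rfl⟩ := hη
  have hν1 : ∑ i, ν i = 1 := by
    simpa [mulVec_diagonal, abs_mul, h.abs_eq_one, abs_of_nonneg (hν0 _)] using hsum
  have hlim := (tendsto_flow_const hκ h.2 (h.graphOf_eq ▸ htree)
    ((h.vecMul_laplacian_eq_zero_iff ν).1 hnull) hν1 (diagonal σ *ᵥ x 0)).congr'
    (h.isSolution hx).eventuallyEq_flow.symm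
  refine tendsto_pi_nhds.2 fun i => ?_
  have hi := (tendsto_pi_nhds.1 hlim i).const_mul (σ i)
  have hdot : ν ⬝ᵥ (diagonal σ *ᵥ x 0) = (diagonal σ *ᵥ ν) ⬝ᵥ x 0 := by
    simp only [dotProduct, mulVec_diagonal]
    exact Finset.sum_congr rfl fun i _ => by ring
  simp only [hdot, mulVec_diagonal, ← mul_assoc, h.mul_self, one_mul] at hi
  simpa [mul_comm] using hi

/-- The half-plane sign of a nonzero complex number, an odd function with values `±1`. -/
noncomputable def halfPlaneSign (z : ℂ) : ℝ :=
  open Classical in if 0 < z.im ∨ z.im = 0 ∧ 0 < z.re then 1 else -1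

theorem halfPlaneSign_eq (z : ℂ) : halfPlaneSign z = 1 ∨ halfPlaneSign z = -1 := by
  unfold halfPlaneSign; split_ifs <;> simp

theorem halfPlaneSign_neg {z : ℂ} (hz : z ≠ 0) : halfPlaneSign (-z) = -halfPlaneSign z := by
  have hz' : ¬(z.re = 0 ∧ z.im = 0) := fun h => hz (Complex.ext h.1 h.2)
  simp only [halfPlaneSign, Complex.neg_im, Complex.neg_re]
  grind

/-- Since `A` is real, `A i j ≠ 0` forces `ζ i = ± ζ j` with the sign of `A i j`. Any odd
`±1`-valued function of `ζ` therefore gives a switching. -/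
theorem EssentiallyNonnegative.exists_isSignSwitching
    (h : EssentiallyNonnegative (A.map Complex.ofReal)) : ∃ σ, IsSignSwitching A σ := by
  obtain ⟨B, hB, ζ, hζ⟩ := h
  have hunit : IsUnit (diagCircle ζ).det := by
    simp [diagCircle, Matrix.det_diagonal, Finset.prod_ne_zero_iff]
  have hmul : diagCircle ζ * B.map Complex.ofReal = A.map Complex.ofReal * diagCircle ζ := by
    rw [hζ, mul_assoc, Matrix.mul_nonsing_inv_cancel_left _ _ hunit]
  have hent (i j : Fin n) : (ζ i : ℂ) * B i j = A i j * ζ j := by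
    simpa [diagCircle, Matrix.mul_diagonal, Matrix.diagonal_mul] using congrFun₂ hmul i j
  refine ⟨fun i => halfPlaneSign (ζ i), fun i => halfPlaneSign_eq _, fun i j => ?_⟩
  rw [diagonal_mul_mul_diagonal_apply]
  have habs : B i j = |A i j| := by
    simpa [abs_of_nonneg (hB i j), Circle.norm_coe] using congrArg norm (hent i j)
  have hij := hent i j
  rw [habs] at hij
  have hsq (z : ℂ) : halfPlaneSign z * halfPlaneSign z = 1 := by
    rcases halfPlaneSign_eq z with hz | hz <;> simp [hz]
  rcases lt_trichotomy (A i j) 0 with hneg | hzero | hpos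
  · have hA : (A i j : ℂ) ≠ 0 := by exact_mod_cast hneg.ne
    have hζij : (ζ i : ℂ) = -ζ j := by
      refine mul_right_cancel₀ hA ?_
      rw [abs_of_neg hneg] at hij
      push_cast at hij
      linear_combination -hij
    rw [hζij, halfPlaneSign_neg (Circle.coe_ne_zero _)]
    linarith [congrArg (A i j * ·) (hsq (ζ j))]
  · simp [hzero]
  · have hA : (A i j : ℂ) ≠ 0 := by exact_mod_cast hpos.ne'
    have hζij : (ζ i : ℂ) = ζ j := by
      refine mul_right_cancel₀ hA ?_
      rw [abs_of_pos hpos] at hij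
      linear_combination hij
    rw [hζij]
    linarith [congrArg (A i j * ·) (hsq (ζ j))]

theorem IsSignSwitching.essentiallyNonnegative (h : IsSignSwitching A σ) :
    EssentiallyNonnegative (A.map Complex.ofReal) := by
  have hcircle (i : Fin n) : ∃ z : Circle, (z : ℂ) = σ i :=
    ⟨⟨σ i, by simp [Submonoid.unitSphere, h.abs_eq_one]⟩, rfl⟩
  choose ζ hζ using hcircle
  have hinv : (diagCircle ζ)⁻¹ = diagCircle ζ := by
    refine Matrix.inv_eq_right_inv ?_
    rw [diagCircle, diagonal_mul_diagonal]
    simp [hζ, ← Complex.ofReal_mul, h.mul_self]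
  refine ⟨diagonal σ * A * diagonal σ, h.2, ζ, ?_⟩
  rw [hinv]
  ext i j
  simp [diagCircle, hζ, Matrix.mul_diagonal, Matrix.diagonal_mul]

end Switching

/-! ### Necessity of the two conditions -/

section Converse

variable {n : ℕ} {κ : ℝ} {A : Matrix (Fin n) (Fin n) ℝ}

/-- An equilibrium whose entries have a common positive modulus yields a sign switching. -/
theorem isSignSwitching_of_laplacian_eq_zero {w : Fin n → ℝ} {a : ℝ} (ha : 0 < a)
    (hw : ∀ i, w i = a ∨ w i = -a) (h : laplacian A *ᵥ w = 0) :
    IsSignSwitching A (fun i => w i / a) := by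
  refine ⟨fun i => ?_, fun i j => ?_⟩
  · rcases hw i with hi | hi
    · exact Or.inl (by simp only [hi, div_self ha.ne'])
    · exact Or.inr (by simp only [hi, neg_div, div_self ha.ne'])
  have habs (i : Fin n) : |w i| = a := by
    rcases hw i with hi | hi <;> simp [hi, ha.le]
  -- These nonnegative terms add up to `w i * (L w) i = 0`, so each vanishes.
  have hnonneg (j : Fin n) : 0 ≤ |A i j| * a ^ 2 - w i * A i j * w j := by
    have h1 := le_abs_self (w i * A i j * w j)
    rw [abs_mul, abs_mul, habs, habs] at h1
    linarith
  have hsum : ∑ j, (|A i j| * a ^ 2 - w i * A i j * w j) = 0 := by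
    have h0 : (laplacian A *ᵥ w) i = 0 := congrFun h i
    rw [laplacian_mulVec_apply] at h0
    have hsq : w i * w i = a ^ 2 := by rw [← abs_mul_abs_self, habs, sq]
    calc ∑ j, (|A i j| * a ^ 2 - w i * A i j * w j)
        = w i * ((∑ j, |A i j|) * w i - ∑ j, A i j * w j) := by
          rw [Finset.sum_sub_distrib, ← Finset.sum_mul, mul_sub, Finset.mul_sum, ← hsq]
          congr 1
          · ring
          · exact Finset.sum_congr rfl fun j _ => by ring
      _ = 0 := by rw [h0, mul_zero]
  have hij := (Finset.sum_eq_zero_iff_of_nonneg fun j _ => hnonneg j).1 hsum j (Finset.mem_univ j)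
  have hpos : 0 ≤ w i * A i j * w j := by
    have := mul_nonneg (abs_nonneg (A i j)) (sq_nonneg a)
    linarith
  rw [diagonal_mul_mul_diagonal_apply]
  have : w i / a * A i j * (w j / a) = w i * A i j * w j / (a * a) := by
    field_simp
  rw [this]
  positivity

theorem AchievesBipartiteConsensus.exists_isSignSwitching (hκ : 0 < κ)
    (h : AchievesBipartiteConsensus κ A) : ∃ σ, IsSignSwitching A σ := by
  obtain ⟨-, x, hx, a, ha, hconv⟩ := h
  have hlim (i : Fin n) : ∃ w, (w = a ∨ w = -a) ∧ Tendsto (fun t => x t i) atTop (𝓝 w) := by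
    rcases hconv i with hi | hi
    exacts [⟨a, Or.inl rfl, hi⟩, ⟨-a, Or.inr rfl, hi⟩]
  choose w hw hwlim using hlim
  exact ⟨_, isSignSwitching_of_laplacian_eq_zero ha hw <| laplacian_eq_zero_of_tendsto_flow hκ.ne' <|
    (tendsto_pi_nhds.2 hwlim).congr' hx.eventuallyEq_flow⟩

/-- On a set of vertices without edges coming in from outside, a vanishing state keeps vanishing. -/
theorem flow_apply_eq_zero_of_closed {S : Set (Fin n)}
    (hS : ∀ i ∈ S, ∀ j, A i j ≠ 0 → j ∈ S) {z : Fin n → ℝ} (hz : ∀ i ∈ S, z i = 0) (t : ℝ) :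
    ∀ i ∈ S, flow κ A t z i = 0 := by
  let W : Submodule ℝ (Fin n → ℝ) :=
    { carrier := {z | ∀ i ∈ S, z i = 0}
      zero_mem' := fun _ _ => rfl
      add_mem' := fun {y z} hy hz i hi => by simp [hy i hi, hz i hi]
      smul_mem' := fun c z hz i hi => by simp [hz i hi] }
  refine flow_apply_mem (W := W) (fun w hw i hi => ?_) hz t
  have hterm (j : Fin n) : A i j * w j = 0 := by
    by_cases hij : A i j = 0
    · simp [hij]
    · simp [hw j (hS i hi j hij)]
  simp [generator_apply, laplacian_mulVec_apply, hterm, hw i hi]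

/-- Common ancestors make reachability a directed relation, and a finite directed family has a
bound, here a root. -/
theorem hasSpanningTree_of_common_ancestors {V : Type*} [Finite V] [Nonempty V] {G : Digraph V}
    (h : ∀ u v, ∃ w, Relation.ReflTransGen G.Adj w u ∧ Relation.ReflTransGen G.Adj w v) :
    HasSpanningTree G := by
  have hdir : Directed (fun u v => Relation.ReflTransGen G.Adj v u) (id : V → V) := h
  have : IsTrans V (fun u v => Relation.ReflTransGen G.Adj v u) := ⟨fun _ _ _ h₁ h₂ => h₂.trans h₁⟩
  obtain ⟨r, hr⟩ := hdir.finite_le id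
  exact ⟨r, fun v _ => hr v⟩

theorem AchievesBipartiteConsensus.hasSpanningTree (hn : 0 < n) {σ : Fin n → ℝ}
    (hσ : IsSignSwitching A σ) (h : AchievesBipartiteConsensus κ A) :
    HasSpanningTree (graphOf A) := by
  have : Nonempty (Fin n) := ⟨⟨0, hn⟩⟩
  refine hasSpanningTree_of_common_ancestors fun u v => ?_
  by_contra! hdisj
  classical
  -- This state agrees with the equilibrium `σ` on the ancestors of `u` and vanishes on those of
  -- `v`; hence `u` stays at `σ u` and `v` at `0`, which have different moduli.
  let z : Fin n → ℝ := fun i => if Relation.ReflTransGen (graphOf A).Adj i u then σ i else 0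
  have hclosed (w i : Fin n) (hi : Relation.ReflTransGen (graphOf A).Adj i w) (j : Fin n)
      (hij : A i j ≠ 0) : Relation.ReflTransGen (graphOf A).Adj j w := .head hij hi
  have hu (t : ℝ) (ht : 0 ≤ t) : flow κ A t z u = σ u := by
    have h0 := flow_apply_eq_zero_of_closed (κ := κ)
      (S := {i | Relation.ReflTransGen (graphOf A).Adj i u}) (hclosed u) (z := z - σ)
      (fun i hi => by simpa [z, sub_eq_zero] using fun hi' => absurd hi hi') t u .refl
    rw [map_sub, flow_apply_of_laplacian_eq_zero hσ.laplacian_mulVec_self ht] at h0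
    exact sub_eq_zero.1 h0
  have hv (t : ℝ) : flow κ A t z v = 0 :=
    flow_apply_eq_zero_of_closed (S := {i | Relation.ReflTransGen (graphOf A).Adj i v})
      (hclosed v) (fun i hi => if_neg fun hi' => hdisj i hi' hi) t v .refl
  obtain ⟨a, -, hconv⟩ := h.1 _ (isSolution_flow z)
  have hlimu : Tendsto (fun t => flow κ A t z u) atTop (𝓝 (σ u)) :=
    tendsto_const_nhds.congr' <| (eventually_ge_atTop 0).mono fun t ht => (hu t ht).symm
  have hlimv : Tendsto (fun t => flow κ A t z v) atTop (𝓝 0) := by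
    simp only [hv, tendsto_const_nhds]
  have ha : a = 0 := by
    rcases hconv v with h' | h'
    · exact tendsto_nhds_unique h' hlimv
    · exact neg_eq_zero.1 (tendsto_nhds_unique h' hlimv)
  have hu0 : σ u = 0 := by
    subst ha
    rcases hconv u with h' | h'
    · exact tendsto_nhds_unique hlimu h'
    · simpa using tendsto_nhds_unique hlimu h'
  simpa [hu0] using hσ.mul_self u

end Converse

theorem IsSignSwitching.achievesBipartiteConsensus {n : ℕ} {κ : ℝ}
    {A : Matrix (Fin n) (Fin n) ℝ} {σ : Fin n → ℝ} (hκ : 0 < κ) (h : IsSignSwitching A σ)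
    (htree : HasSpanningTree (graphOf A)) : AchievesBipartiteConsensus κ A := by
  have hconv {x : ℝ → Fin n → ℝ} {c : ℝ} (hx : Tendsto x atTop (𝓝 (c • σ))) :
      ConvergesUpToSign x |c| := by
    intro i
    have hi := tendsto_pi_nhds.1 hx i
    rcases abs_choice c with hc | hc <;> rcases h.1 i with hσ | hσ <;> rw [hc] <;>
      simp only [Pi.smul_apply, hσ, smul_eq_mul, mul_one, mul_neg] at hi <;> simp [hi]
  refine ⟨fun x hx => ?_, fun _ => σ, isSolution_const h.laplacian_mulVec_self, 1, one_pos, ?_⟩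
  · obtain ⟨η, hη⟩ := h.exists_isNormalizedLeftNull hκ htree
    exact ⟨_, abs_nonneg _, hconv (h.tendsto hκ htree hη hx)⟩
  · simpa using hconv (x := fun _ => σ) (c := 1) (by simp)

end SignedConsensus

theorem mainTheorem7 {n : ℕ} (hn : 0 < n) (A : Matrix (Fin n) (Fin n) ℝ)
    (hA : ∀ i, A i i = 0) (κ : ℝ) (hκ : 0 < κ) :
    (SignedConsensus.AchievesBipartiteConsensus κ A ↔
      SignedConsensus.EssentiallyNonnegative (A.map Complex.ofReal) ∧
        SignedConsensus.HasSpanningTree (SignedConsensus.graphOf A)) ∧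
    (SignedConsensus.EssentiallyNonnegative (A.map Complex.ofReal) ∧
        SignedConsensus.HasSpanningTree (SignedConsensus.graphOf A) →
      (∃ σ : Fin n → ℝ, SignedConsensus.IsSignSwitching A σ) ∧
      ∀ σ : Fin n → ℝ, SignedConsensus.IsSignSwitching A σ →
        (∃ η : Fin n → ℝ, SignedConsensus.IsNormalizedLeftNull A σ η) ∧
        ∀ η : Fin n → ℝ, SignedConsensus.IsNormalizedLeftNull A σ η →
          ∀ x : ℝ → Fin n → ℝ, SignedConsensus.IsSolution κ A x →
            Filter.Tendsto x Filter.atTop (nhds ((η ⬝ᵥ x 0) • σ))) := by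
  refine ⟨⟨fun h => ?_, fun ⟨hess, htree⟩ => ?_⟩, fun ⟨hess, htree⟩ =>
    ⟨hess.exists_isSignSwitching, fun σ hσ => ⟨hσ.exists_isNormalizedLeftNull hκ htree,
      fun η hη x hx => hσ.tendsto hκ htree hη hx⟩⟩⟩
  · obtain ⟨σ, hσ⟩ := h.exists_isSignSwitching hκ
    exact ⟨hσ.essentiallyNonnegative, h.hasSpanningTree hn hσ⟩
  · obtain ⟨σ, hσ⟩ := hess.exists_isSignSwitching
    exact hσ.achievesBipartiteConsensus hκ htree
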